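/- \textbf{Setting.} Let $K,N\ge 1$. A server has $N$ independent files $W_1,\dots,W_N$, each uniform on $2^F$ values ($F$ bits), and serves $K$ users through an error-free broadcast link. Using $\mathbf W=(W_1,\dots,W_N)$ and private randomness independent of the files and of the demands, it fills the cache $Z_k$ of each user $k$ before the demands are known; a cache has at most $MF$ bits. Then user $k$ privately tells the server its demand $d_k\in\{1,\dots,N\}$, where $d_1,\dots,d_K$ are i.i.d. with a common law that gives each file positive probability, and are independent of the files and the server's randomness. The server, knowing all of this, broadcasts a message $X$ of at most $RF$ bits. All auxiliary data that a user needs is counted as part of $Z_k$ or $X$. Such a scheme is a \emph{$(K,N)$ demand-private coded caching scheme} with memory $M$ and rate $R$ if for every user $k$ $$H(W_{d_k}\mid Z_k,d_k,X)=0\qquad\text{and}\qquad I\big((d_j)_{j\ne k}\,;\,d_k,Z_k,X\mid \mathbf W\big)=0 .$$ The pair $(M,R)$ is \emph{achievable} if for every $\varepsilon>0$ and all sufficiently large $F$ there is such a scheme with memory $M+\varepsilon$ and rate $R+\varepsilon$. Let $R^{p*}_{K,N}(M)$ be the minimum of all $R$ such that $(M,R)$ is achievable. \textbf{Theorem.}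 The memory-rate pair $$\left(\frac{1}{K(N-1)+1},\;N\Big(1-\frac{1}{K(N-1)+1}\Big)\right)$$ is achievable. Moreover, if $K\ge 2$ (or $N=1$), then for every $M\in\big[0,\frac{1}{K(N-1)+1}\big]$ the minimum $R^{p*}_{K,N}(M)$ exists and $$R^{p*}_{K,N}(M)=N(1-M),$$ and every $(K,N)$ demand-private coded caching scheme, of any file size $F\ge 1$, with memory $M$ and rate $R$ satisfies $R\ge N(1-M)$. -/

import Mathlib

namespace CodedCaching

section Entropy

variable {Ω α β γ : Type*} [Fintype Ω] [Fintype α] [Fintype β] [Fintype γ]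

open Classical in
/-- The probability that `X = x`, where the finite sample space `Ω` carries the probability mass
function `P`. -/
noncomputable def probEq (P : Ω → ℝ) (X : Ω → α) (x : α) : ℝ :=
  ∑ ω, if X ω = x then P ω else 0

/-- Shannon entropy `H(X)` of a random variable with finitely many values (in nats). -/
noncomputable def entropy (P : Ω → ℝ) (X : Ω → α) : ℝ :=
  ∑ x, Real.negMulLog (probEq P X x)

/-- Conditional entropy `H(X | Y) = H(X, Y) - H(Y)`. -/
noncomputable def condEntropy (P : Ω → ℝ) (X : Ω → α) (Y : Ω → β) : ℝ :=
  entropy P (fun ω => (X ω, Y ω)) - entropy P Y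

/-- Conditional mutual information
`I(X ; Y | V) = H(X | V) - H(X | Y, V)`. -/
noncomputable def condMutualInfo (P : Ω → ℝ) (X : Ω → α) (Y : Ω → β) (V : Ω → γ) : ℝ :=
  condEntropy P X V - condEntropy P X (fun ω => (Y ω, V ω))

end Entropy

/-- The contents of the `N` files, each of `F` bits. -/
abbrev Files (N F : ℕ) : Type := Fin N → Fin (2 ^ F)

/-- A demand vector: user `k` asks for file `d k`. -/
abbrev Demands (K N : ℕ) : Type := Fin K → Fin N

/-- A coded caching scheme with `K` users and `N` files of `F` bits each. The server may use private
randomness, drawn from `Rand` according to `randLaw` independently of the files and the demands.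
The cache contents are produced without knowledge of the demands, the broadcast message with
knowledge of everything the server has. Any auxiliary data that a user has to be given (keys,
headers) is part of its cache content or of the broadcast message. -/
structure CachingScheme (K N F : ℕ) where
  /-- values of the private randomness of the server -/
  Rand : Type
  /-- possible cache contents of a user -/
  Cache : Type
  /-- possible broadcast messages -/
  Msg : Type
  [fintypeRand : Fintype Rand]
  [fintypeCache : Fintype Cache]
  [fintypeMsg : Fintype Msg]
  randLaw : Rand → ℝ
  randLaw_nonneg : ∀ θ, 0 ≤ randLaw θ
  randLaw_sum : ∑ θ, randLaw θ = 1
  /-- placement phase: the cache content of each user -/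
  place : Fin K → Rand → Files N F → Cache
  /-- delivery phase: the broadcast message -/
  deliver : Rand → Files N F → Demands K N → Msg

attribute [instance] CachingScheme.fintypeRand CachingScheme.fintypeCache
  CachingScheme.fintypeMsg

namespace CachingScheme

variable {K N F : ℕ} (C : CachingScheme K N F)

/-- Sample space: server randomness, files, demands. -/
abbrev Sample : Type := C.Rand × Files N F × Demands K N

/-- Joint law: the server randomness, the files `W_n` (each uniform on `2 ^ F` values) and the
demands `d_k` (each with law `p`) are all independent. -/
noncomputable def law (p : Fin N → ℝ) (ω : C.Sample) : ℝ :=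
  C.randLaw ω.1 * (∏ _n : Fin N, (1 / 2 ^ F : ℝ)) * ∏ k, p (ω.2.2 k)

/-- The tuple `W` of all files. -/
def allFiles (ω : C.Sample) : Files N F := ω.2.1

/-- The demand `d_k` of user `k`. -/
def demand (k : Fin K) (ω : C.Sample) : Fin N := ω.2.2 k

/-- The demands of all users but `k`. -/
def otherDemands (k : Fin K) (ω : C.Sample) : {j : Fin K // j ≠ k} → Fin N := fun j => ω.2.2 j

/-- The file `W_{d_k}` that user `k` demands. -/
def demandedFile (k : Fin K) (ω : C.Sample) : Fin (2 ^ F) := ω.2.1 (ω.2.2 k)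

/-- The cache content `Z_k` of user `k`. -/
def cacheContent (k : Fin K) (ω : C.Sample) : C.Cache := C.place k ω.1 ω.2.1

/-- The broadcast message `X`. -/
def message (ω : C.Sample) : C.Msg := C.deliver ω.1 ω.2.1 ω.2.2

/-- Decodability: `H(W_{d_k} | Z_k, d_k, X) = 0` for every user `k`. -/
def IsDecodable (p : Fin N → ℝ) : Prop :=
  ∀ k : Fin K, condEntropy (C.law p) (C.demandedFile k)
    (fun ω => (C.cacheContent k ω, C.demand k ω, C.message ω)) = 0

/-- Demand privacy: `I(d_{-k} ; d_k, Z_k, X | W) = 0` for every user `k`, where `d_{-k}` are the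
demands of the other users. -/
def IsPrivate (p : Fin N → ℝ) : Prop :=
  ∀ k : Fin K, condMutualInfo (C.law p) (C.otherDemands k)
    (fun ω => (C.demand k ω, C.cacheContent k ω, C.message ω)) C.allFiles = 0

/-- Every cache holds at most `M * F` bits and the broadcast message has at most `R * F` bits. -/
def HasMemoryRate (M R : ℝ) : Prop :=
  (Fintype.card C.Cache : ℝ) ≤ (2 : ℝ) ^ (M * F) ∧ (Fintype.card C.Msg : ℝ) ≤ (2 : ℝ) ^ (R * F)

/-- `C` is a demand-private coded caching scheme with memory `M` and rate `R`. -/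
def IsDemandPrivateScheme (p : Fin N → ℝ) (M R : ℝ) : Prop :=
  C.IsDecodable p ∧ C.IsPrivate p ∧ C.HasMemoryRate M R

end CachingScheme

/-- The memory-rate pair `(M, R)` is achievable with demand privacy by `K` users and `N` files with
demand law `p`: up to an arbitrarily small excess in the normalized sizes, it is attained by
demand-private schemes for all sufficiently large file sizes. -/
def PrivatelyAchievable (K N : ℕ) (p : Fin N → ℝ) (M R : ℝ) : Prop :=
  ∀ ε : ℝ, 0 < ε → ∃ F₀ : ℕ, ∀ F : ℕ, F₀ ≤ F →
    ∃ C : CachingScheme K N F, C.IsDemandPrivateScheme p (M + ε) (R + ε)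

/-- `R` is the optimal demand-private rate `R^{p*}_{K,N}(M)`: the minimum of the rates that are
achievable with demand privacy at memory `M`. -/
def IsOptimalPrivateRate (K N : ℕ) (p : Fin N → ℝ) (M R : ℝ) : Prop :=
  IsLeast {R' : ℝ | PrivatelyAchievable K N p M R'} R

end CodedCaching

/-!
*Converse.* By privacy towards another user `k'`, any demand of user `k` is compatible with the
message and the files that actually occur. So there is a function assigning to every tuple `w` of
files a message that is compatible with `w` and with every demand of user `k`; together with the
`N` cache contents of user `k` in these situations, it determines `w` by decodability. Hence
`2 ^ (N * F) ≤ #Msg * #Cache ^ N`.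

*Achievability.* Every file is an array over an abelian group, with one row for each user, one
column for each file and equal row sums. Virtual user `(k, s)` caches the sum of the `(k, s)`
entries of all files, and user `k` plays the role of `(k, s)` for a uniformly random `s`. The shifts
`q k = d k - s` are broadcast, and virtual user `(k, s)` is served as if it demanded file `s + q k`.
The files demanded by the virtual users of a row are then all distinct, so subtracting from file `m`
its row sum at the virtual users who demand it leaves an array with zero row sums. These arrays are
broadcast; they leave one unknown in the sum cached by a virtual user, the row sum of the file it
demands. User `k` sees of the demands only `d k` and the shifts, which are uniform and independent
of the demands.
-/

namespace CodedCaching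

open Finset Real

section Gibbs

variable {ι : Type*} [Fintype ι]

theorem eq_of_sum_mul_log_div_eq_zero {r q : ι → ℝ} (hr : ∀ i, 0 ≤ r i) (hq : ∀ i, 0 ≤ q i)
    (hrq : ∀ i, q i = 0 → r i = 0) (hsum : ∑ i, r i = ∑ i, q i)
    (h : ∑ i, r i * log (r i / q i) = 0) : r = q := by
  have hterm : ∀ i, q i * InformationTheory.klFun (r i / q i) =
      r i * log (r i / q i) + q i - r i := fun i => by
    rcases eq_or_ne (q i) 0 with h0 | h0
    · simp [h0, hrq i h0]
    · rw [InformationTheory.klFun_apply]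
      field_simp
  have hnonneg : ∀ i ∈ univ, 0 ≤ q i * InformationTheory.klFun (r i / q i) := fun i _ =>
    mul_nonneg (hq i) (InformationTheory.klFun_nonneg (div_nonneg (hr i) (hq i)))
  have hkl : ∑ i, q i * InformationTheory.klFun (r i / q i) = 0 := by
    simp_rw [hterm, sum_sub_distrib, sum_add_distrib, h, hsum]
    ring
  funext i
  rcases mul_eq_zero.1 ((sum_eq_zero_iff_of_nonneg hnonneg).1 hkl i (mem_univ i)) with h0 | h0
  · rw [h0, hrq i h0]
  · exact eq_of_div_eq_one
      ((InformationTheory.klFun_eq_zero_iff (div_nonneg (hr i) (hq i))).1 h0)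

end Gibbs

section ProbEq

variable {Ω Ω' α β : Type*} [Fintype Ω] [Fintype Ω'] {P : Ω → ℝ} {Q : Ω' → ℝ} {X : Ω → α}
  {Y : Ω → β}

theorem probEq_nonneg (hP : ∀ ω, 0 ≤ P ω) (x : α) : 0 ≤ probEq P X x := by
  classical exact sum_nonneg fun ω _ => ite_nonneg (hP ω) le_rfl

theorem probEq_mono (hP : ∀ ω, 0 ≤ P ω) {x : α} {y : β} (h : ∀ ω, X ω = x → Y ω = y) :
    probEq P X x ≤ probEq P Y y := by
  classical
  refine sum_le_sum fun ω _ => ?_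
  by_cases hx : X ω = x
  · rw [if_pos hx, if_pos (h ω hx)]
  · rw [if_neg hx]
    exact ite_nonneg (hP ω) le_rfl

theorem probEq_pos_iff (hP : ∀ ω, 0 ≤ P ω) {x : α} :
    0 < probEq P X x ↔ ∃ ω, 0 < P ω ∧ X ω = x := by
  classical
  rw [probEq, sum_pos_iff_of_nonneg fun ω _ => ite_nonneg (hP ω) le_rfl]
  refine exists_congr fun ω => ?_
  by_cases hx : X ω = x <;> simp [hx]

theorem probEq_pair_lt (hP : ∀ ω, 0 ≤ P ω) {x : α} {ω : Ω} (hω : 0 < P ω) (hx : X ω ≠ x) :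
    probEq P (fun ω => (X ω, Y ω)) (x, Y ω) < probEq P Y (Y ω) := by
  classical
  refine sum_lt_sum (fun ω' _ => ?_) ⟨ω, mem_univ ω, by simpa [hx] using hω⟩
  by_cases hY : Y ω' = Y ω <;> by_cases hX : X ω' = x <;> simp [hX, hY, hP ω']

theorem sum_probEq_mul [Fintype α] (P : Ω → ℝ) (X : Ω → α) (f : α → ℝ) :
    ∑ x, probEq P X x * f x = ∑ ω, P ω * f (X ω) := by
  classical
  simp only [probEq, sum_mul, ite_mul, zero_mul]
  rw [sum_comm]
  simp

theorem sum_probEq [Fintype α] (P : Ω → ℝ) (X : Ω → α) : ∑ x, probEq P X x = ∑ ω, P ω := by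
  simpa using sum_probEq_mul P X 1

theorem probEq_comp_equiv (σ : Ω ≃ Ω') (hσ : ∀ ω, P ω = Q (σ ω)) (X : Ω' → α) (x : α) :
    probEq P (fun ω => X (σ ω)) x = probEq Q X x := by
  classical
  simp only [probEq, hσ]
  exact σ.sum_comp fun ω => if X ω = x then Q ω else 0

end ProbEq

section Independence

variable {Ω Ω' α β γ δ : Type*} [Fintype Ω] [Fintype Ω']

/-- Independence of two random variables with finitely many values, on a finite sample space with
probability mass function `P`. -/
def IsIndep (P : Ω → ℝ) (X : Ω → α) (Y : Ω → β) : Prop :=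
  ∀ x y, probEq P (fun ω => (X ω, Y ω)) (x, y) = probEq P X x * probEq P Y y

theorem IsIndep.exists_pos {P : Ω → ℝ} {X : Ω → α} {Y : Ω → β} (h : IsIndep P X Y)
    (hP : ∀ ω, 0 ≤ P ω) {ω₁ ω₂ : Ω} (h₁ : 0 < P ω₁) (h₂ : 0 < P ω₂) :
    ∃ ω, 0 < P ω ∧ X ω = X ω₁ ∧ Y ω = Y ω₂ := by
  have hpos : 0 < probEq P (fun ω => (X ω, Y ω)) (X ω₁, Y ω₂) := by
    rw [h]
    exact mul_pos ((probEq_pos_iff hP).2 ⟨ω₁, h₁, rfl⟩) ((probEq_pos_iff hP).2 ⟨ω₂, h₂, rfl⟩)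
  simpa only [Prod.mk.injEq] using (probEq_pos_iff hP).1 hpos

theorem IsIndep.comp_equiv {P : Ω → ℝ} {Q : Ω' → ℝ} {X : Ω' → α} {Y : Ω' → β}
    (h : IsIndep Q X Y) (σ : Ω ≃ Ω') (hσ : ∀ ω, P ω = Q (σ ω)) :
    IsIndep P (fun ω => X (σ ω)) (fun ω => Y (σ ω)) := fun x y => by
  rw [probEq_comp_equiv σ hσ X, probEq_comp_equiv σ hσ Y,
    probEq_comp_equiv σ hσ fun ω => (X ω, Y ω), h]

theorem isIndep_fst_snd [Fintype α] [Fintype β] {p : α → ℝ} {q : β → ℝ}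
    (hpq : ∑ z : α × β, p z.1 * q z.2 = 1) (f : α → γ) (g : β → δ) :
    IsIndep (fun z : α × β => p z.1 * q z.2) (fun z => f z.1) (fun z => g z.2) := by
  classical
  have hpair : ∀ x y, probEq (fun z : α × β => p z.1 * q z.2) (fun z => (f z.1, g z.2)) (x, y) =
      probEq p f x * probEq q g y := fun x y => by
    simp only [probEq, Fintype.sum_prod_type, sum_mul_sum, Prod.mk.injEq, ite_zero_mul_ite_zero]
  have hfst : ∀ x, probEq (fun z : α × β => p z.1 * q z.2) (fun z => f z.1) x =
      probEq p f x * ∑ b, q b := fun x => by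
    simp only [probEq, Fintype.sum_prod_type, sum_mul_sum, ite_mul, zero_mul]
  have hsnd : ∀ y, probEq (fun z : α × β => p z.1 * q z.2) (fun z => g z.2) y =
      (∑ a, p a) * probEq q g y := fun y => by
    simp only [probEq, Fintype.sum_prod_type, sum_mul_sum, mul_ite, mul_zero]
  rw [Fintype.sum_prod_type, ← sum_mul_sum] at hpq
  intro x y
  rw [hpair, hfst, hsnd]
  linear_combination -(probEq p f x * probEq q g y) * hpq

end Independence

section Entropy

variable {Ω α β γ : Type*} [Fintype Ω] [Fintype α] [Fintype β] [Fintype γ] {P : Ω → ℝ} {X : Ω → α}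
  {Y : Ω → β} {V : Ω → γ}

theorem entropy_eq_neg_sum (P : Ω → ℝ) (X : Ω → α) :
    entropy P X = -∑ ω, P ω * log (probEq P X (X ω)) := by
  simp only [entropy, negMulLog, neg_mul, sum_neg_distrib,
    sum_probEq_mul P X fun x => log (probEq P X x)]

theorem entropy_add_sub_entropy_pair (hP : ∀ ω, 0 ≤ P ω) :
    entropy P X + entropy P Y - entropy P (fun ω => (X ω, Y ω)) =
      ∑ z : α × β, probEq P (fun ω => (X ω, Y ω)) z *
        log (probEq P (fun ω => (X ω, Y ω)) z / (probEq P X z.1 * probEq P Y z.2)) := by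
  rw [sum_probEq_mul P (fun ω => (X ω, Y ω)) fun z =>
    log (probEq P (fun ω => (X ω, Y ω)) z / (probEq P X z.1 * probEq P Y z.2))]
  simp only [entropy_eq_neg_sum]
  rw [sub_neg_eq_add, ← neg_add, ← sum_add_distrib, neg_add_eq_sub, ← sum_sub_distrib]
  refine sum_congr rfl fun ω _ => ?_
  rcases (hP ω).eq_or_lt with h0 | h0
  · simp [← h0]
  · have hX : 0 < probEq P X (X ω) := (probEq_pos_iff hP).2 ⟨ω, h0, rfl⟩
    have hY : 0 < probEq P Y (Y ω) := (probEq_pos_iff hP).2 ⟨ω, h0, rfl⟩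
    have hXY : 0 < probEq P (fun ω => (X ω, Y ω)) (X ω, Y ω) :=
      (probEq_pos_iff hP).2 ⟨ω, h0, rfl⟩
    rw [log_div hXY.ne' (mul_pos hX hY).ne', log_mul hX.ne' hY.ne']
    ring

theorem isIndep_of_entropy_pair (hP : ∀ ω, 0 ≤ P ω) (hP_sum : ∑ ω, P ω = 1)
    (h : entropy P (fun ω => (X ω, Y ω)) = entropy P X + entropy P Y) : IsIndep P X Y := by
  have hac : ∀ z : α × β, probEq P X z.1 * probEq P Y z.2 = 0 →
      probEq P (fun ω => (X ω, Y ω)) z = 0 := fun z hz => by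
    refine le_antisymm ?_ (probEq_nonneg hP z)
    rcases mul_eq_zero.1 hz with hz | hz
    · exact (probEq_mono hP fun ω hω => congrArg Prod.fst hω).trans_eq hz
    · exact (probEq_mono hP fun ω hω => congrArg Prod.snd hω).trans_eq hz
  have hsum : ∑ z, probEq P (fun ω => (X ω, Y ω)) z =
      ∑ z : α × β, probEq P X z.1 * probEq P Y z.2 := by
    rw [sum_probEq, Fintype.sum_prod_type, ← sum_mul_sum, sum_probEq, sum_probEq, hP_sum, one_mul]
  have hjoint := eq_of_sum_mul_log_div_eq_zero (fun z => probEq_nonneg hP z)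
    (fun z : α × β => mul_nonneg (probEq_nonneg hP z.1) (probEq_nonneg hP z.2)) hac hsum
    ((entropy_add_sub_entropy_pair hP).symm.trans (sub_eq_zero.2 h.symm))
  exact fun x y => congrFun hjoint (x, y)

theorem IsIndep.entropy_pair (h : IsIndep P X Y) (hP_sum : ∑ ω, P ω = 1) :
    entropy P (fun ω => (X ω, Y ω)) = entropy P X + entropy P Y := by
  simp_rw [entropy, Fintype.sum_prod_type, h _ _, negMulLog_mul, sum_add_distrib, ← mul_sum,
    ← sum_mul, sum_probEq, hP_sum, one_mul]

theorem IsIndep.condMutualInfo_eq_zero (h : IsIndep P X (fun ω => (Y ω, V ω)))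
    (hV : IsIndep P X V) (hP_sum : ∑ ω, P ω = 1) : condMutualInfo P X Y V = 0 := by
  rw [condMutualInfo, condEntropy, condEntropy, h.entropy_pair hP_sum, hV.entropy_pair hP_sum]
  ring

theorem IsIndep.of_condMutualInfo_eq_zero (hV : IsIndep P X V) (hP : ∀ ω, 0 ≤ P ω)
    (hP_sum : ∑ ω, P ω = 1) (h : condMutualInfo P X Y V = 0) :
    IsIndep P X (fun ω => (Y ω, V ω)) := by
  refine isIndep_of_entropy_pair hP hP_sum ?_
  rw [condMutualInfo, condEntropy, condEntropy, hV.entropy_pair hP_sum] at h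
  linarith

theorem condEntropy_eq_sum (P : Ω → ℝ) (X : Ω → α) (Y : Ω → β) :
    condEntropy P X Y = ∑ ω, P ω *
      (log (probEq P Y (Y ω)) - log (probEq P (fun ω => (X ω, Y ω)) (X ω, Y ω))) := by
  simp only [condEntropy, entropy_eq_neg_sum, mul_sub, sum_sub_distrib]
  ring

theorem eq_of_condEntropy_eq_zero (hP : ∀ ω, 0 ≤ P ω) (h : condEntropy P X Y = 0) {ω ω' : Ω}
    (hω : 0 < P ω) (hω' : 0 < P ω') (hY : Y ω = Y ω') : X ω = X ω' := by
  have hpos : ∀ ω, 0 < P ω → 0 < probEq P (fun ω => (X ω, Y ω)) (X ω, Y ω) := fun ω hω =>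
    (probEq_pos_iff hP).2 ⟨ω, hω, rfl⟩
  have hnonneg : ∀ ω ∈ univ, 0 ≤ P ω *
      (log (probEq P Y (Y ω)) - log (probEq P (fun ω => (X ω, Y ω)) (X ω, Y ω))) := fun ω _ => by
    rcases (hP ω).eq_or_lt with h0 | h0
    · simp [← h0]
    · exact mul_nonneg h0.le (sub_nonneg.2
        (log_le_log (hpos ω h0) (probEq_mono hP fun ω hω => congrArg Prod.snd hω)))
  rw [condEntropy_eq_sum, sum_eq_zero_iff_of_nonneg hnonneg] at h
  have hlog := (mul_eq_zero.1 (h ω (mem_univ ω))).resolve_left hω.ne'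
  by_contra hne
  have hlt := probEq_pair_lt (Y := Y) hP hω' (Ne.symm hne)
  rw [← hY] at hlt
  linarith [log_lt_log (hpos ω hω) hlt]

theorem condEntropy_eq_zero_of_determined (h : ∀ ω ω', Y ω = Y ω' → X ω = X ω') :
    condEntropy P X Y = 0 := by
  rw [condEntropy_eq_sum]
  refine sum_eq_zero fun ω _ => ?_
  have hprob : probEq P (fun ω => (X ω, Y ω)) (X ω, Y ω) = probEq P Y (Y ω) := by
    classical
    simp only [probEq, Prod.mk.injEq, and_iff_right_of_imp (h _ ω)]
  rw [hprob, sub_self, mul_zero]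

end Entropy

namespace CachingScheme

section Law

variable {K N F : ℕ} (C : CachingScheme K N F) {p : Fin N → ℝ}

theorem law_nonneg (hp : ∀ i, 0 ≤ p i) (ω : C.Sample) : 0 ≤ C.law p ω :=
  mul_nonneg (mul_nonneg (C.randLaw_nonneg _) (by positivity)) (prod_nonneg fun _ _ => hp _)

theorem law_pos (hp : ∀ i, 0 < p i) {ω : C.Sample} (h : 0 < C.randLaw ω.1) : 0 < C.law p ω :=
  mul_pos (mul_pos h (by positivity)) (prod_pos fun _ _ => hp _)

theorem sum_law (hp : ∑ i, p i = 1) : ∑ ω, C.law p ω = 1 := by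
  have hdemands : ∑ d : Demands K N, ∏ k, p (d k) = 1 := by
    rw [← Fintype.prod_sum fun (_ : Fin K) i => p i]
    simp [hp]
  simp [law, Fintype.sum_prod_type, ← mul_sum, hdemands, C.randLaw_sum]

theorem exists_randLaw_pos : ∃ θ, 0 < C.randLaw θ := by
  by_contra! h
  linarith [C.randLaw_sum, sum_nonpos fun θ (_ : θ ∈ univ) => h θ]

/-- The sample space as a product whose first factor consists of the demands of all users but `k`;
the law of a sample is a product law with respect to this decomposition. -/
def splitDemands (k : Fin K) :
    C.Sample ≃ ({j : Fin K // j ≠ k} → Fin N) × (C.Rand × Files N F × Fin N) where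
  toFun ω := (C.otherDemands k ω, ω.1, ω.2.1, ω.2.2 k)
  invFun z := (z.2.1, z.2.2.1, (Equiv.funSplitAt k (Fin N)).symm (z.2.2.2, z.1))
  left_inv ω := by
    simp only [Prod.ext_iff, true_and]
    exact (Equiv.funSplitAt k (Fin N)).symm_apply_apply ω.2.2
  right_inv z := by
    have h := (Equiv.funSplitAt k (Fin N)).apply_symm_apply (z.2.2.2, z.1)
    exact Prod.ext (congrArg Prod.snd h)
      (Prod.ext rfl (Prod.ext rfl (congrArg Prod.fst h)))

theorem isIndep_otherDemands (hp : ∑ i, p i = 1) (k : Fin K) {β : Type*}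
    (g : C.Rand × Files N F × Fin N → β) :
    IsIndep (C.law p) (C.otherDemands k) (fun ω => g (ω.1, ω.2.1, ω.2.2 k)) := by
  let others : ({j : Fin K // j ≠ k} → Fin N) → ℝ := fun e => ∏ j, p (e j)
  let rest : C.Rand × Files N F × Fin N → ℝ := fun t =>
    C.randLaw t.1 * (∏ _n : Fin N, (1 / 2 ^ F : ℝ)) * p t.2.2
  have hlaw : ∀ ω, C.law p ω =
      others (C.splitDemands k ω).1 * rest (C.splitDemands k ω).2 := fun ω => by
    rw [law, Fintype.prod_eq_mul_prod_subtype_ne (fun j => p (ω.2.2 j)) k]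
    simp only [others, rest, splitDemands, otherDemands, Equiv.coe_fn_mk]
    ring
  have hsum : ∑ z : ({j : Fin K // j ≠ k} → Fin N) × (C.Rand × Files N F × Fin N),
      others z.1 * rest z.2 = 1 := by
    rw [← (C.splitDemands k).sum_comp, ← C.sum_law hp]
    exact sum_congr rfl fun ω _ => (hlaw ω).symm
  exact (isIndep_fst_snd hsum id g).comp_equiv (C.splitDemands k) hlaw

theorem isIndep_otherDemands_allFiles (hp : ∑ i, p i = 1) (k : Fin K) :
    IsIndep (C.law p) (C.otherDemands k) C.allFiles :=
  C.isIndep_otherDemands hp k fun t => t.2.1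

end Law

section Converse

variable {K N F : ℕ} {C : CachingScheme K N F} {p : Fin N → ℝ}

theorem IsPrivate.exists_sample (h : C.IsPrivate p) (hp : ∀ i, 0 ≤ p i) (hp_sum : ∑ i, p i = 1)
    (k : Fin K) {ω₁ ω₂ : C.Sample} (h₁ : 0 < C.law p ω₁) (h₂ : 0 < C.law p ω₂) :
    ∃ ω, 0 < C.law p ω ∧ C.otherDemands k ω = C.otherDemands k ω₁ ∧
      C.message ω = C.message ω₂ ∧ C.allFiles ω = C.allFiles ω₂ := by
  have hind := (C.isIndep_otherDemands_allFiles hp_sum k).of_condMutualInfo_eq_zero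
    (C.law_nonneg hp) (C.sum_law hp_sum) (h k)
  obtain ⟨ω, hω, hothers, hview⟩ := hind.exists_pos (C.law_nonneg hp) h₁ h₂
  simp only [Prod.mk.injEq] at hview
  exact ⟨ω, hω, hothers, hview.1.2.2, hview.2⟩

theorem IsPrivate.exists_message_forall_demand (h : C.IsPrivate p) (hp : ∀ i, 0 < p i)
    (hp_sum : ∑ i, p i = 1) (hKN : 2 ≤ K ∨ N = 1) (k : Fin K) (w : Files N F) :
    ∃ x : C.Msg, ∀ n : Fin N, ∃ ω : C.Sample,
      0 < C.law p ω ∧ C.message ω = x ∧ C.allFiles ω = w ∧ C.demand k ω = n := by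
  obtain ⟨θ, hθ⟩ := C.exists_randLaw_pos
  obtain ⟨n₀⟩ : Nonempty (Fin N) := by
    by_contra! hN
    simp at hp_sum
  have hpos : ∀ n, 0 < C.law p (θ, w, fun _ => n) := fun _ => C.law_pos hp hθ
  refine ⟨C.message (θ, w, fun _ => n₀), fun n => ?_⟩
  rcases hKN with hK | rfl
  · have : Nontrivial (Fin K) := Fin.nontrivial_iff_two_le.2 hK
    obtain ⟨k', hk'⟩ := exists_ne k
    obtain ⟨ω, hω, hothers, hmsg, hfiles⟩ :=
      h.exists_sample (fun i => (hp i).le) hp_sum k' (hpos n) (hpos n₀)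
    exact ⟨ω, hω, hmsg, hfiles, congrFun hothers ⟨k, hk'.symm⟩⟩
  · exact ⟨_, hpos n₀, rfl, rfl, Subsingleton.elim _ _⟩

theorem card_files_le (hdec : C.IsDecodable p) (hpriv : C.IsPrivate p) (hp : ∀ i, 0 < p i)
    (hp_sum : ∑ i, p i = 1) (hKN : 2 ≤ K ∨ N = 1) (k : Fin K) :
    (2 ^ F) ^ N ≤ Fintype.card C.Msg * Fintype.card C.Cache ^ N := by
  choose x ω hpos hmsg hfiles hdemand using
    hpriv.exists_message_forall_demand hp hp_sum hKN k
  have hfile : ∀ w n, C.demandedFile k (ω w n) = w n := fun w n => calc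
    C.demandedFile k (ω w n) = C.allFiles (ω w n) (C.demand k (ω w n)) := rfl
    _ = w n := by rw [hfiles, hdemand]
  have hinj : Function.Injective fun w => (x w, fun n => C.cacheContent k (ω w n)) := by
    intro w w' h
    obtain ⟨hx, hcache⟩ := Prod.mk.inj h
    funext n
    rw [← hfile w, ← hfile w']
    refine eq_of_condEntropy_eq_zero (C.law_nonneg fun i => (hp i).le) (hdec k)
      (hpos w n) (hpos w' n) ?_
    rw [congrFun hcache n, hdemand, hdemand, hmsg, hmsg, hx]
  simpa using Fintype.card_le_of_injective _ hinj

theorem IsDemandPrivateScheme.rate_lower_bound {M R : ℝ} (h : C.IsDemandPrivateScheme p M R)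
    (hp : ∀ i, 0 < p i) (hp_sum : ∑ i, p i = 1) (hK : 1 ≤ K) (hKN : 2 ≤ K ∨ N = 1)
    (hF : 1 ≤ F) : (N : ℝ) * (1 - M) ≤ R := by
  obtain ⟨hdec, hpriv, hcache, hmsg⟩ := h
  have hcard : ((2 : ℝ) ^ F) ^ N ≤ Fintype.card C.Msg * (Fintype.card C.Cache : ℝ) ^ N :=
    mod_cast card_files_le hdec hpriv hp hp_sum hKN ⟨0, hK⟩
  have hpow : (2 : ℝ) ^ ((F : ℝ) * N) ≤ 2 ^ (R * F + M * F * N) := calc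
    (2 : ℝ) ^ ((F : ℝ) * N) = ((2 : ℝ) ^ F) ^ N := by
      rw [rpow_mul_natCast zero_le_two, rpow_natCast]
    _ ≤ Fintype.card C.Msg * (Fintype.card C.Cache : ℝ) ^ N := hcard
    _ ≤ (2 : ℝ) ^ (R * F) * ((2 : ℝ) ^ (M * F)) ^ N := by gcongr
    _ = 2 ^ (R * F + M * F * N) := by rw [rpow_add two_pos, rpow_mul_natCast zero_le_two (M * F)]
  have hexp : (F : ℝ) * N ≤ R * F + M * F * N := (rpow_le_rpow_left_iff one_lt_two).1 hpow
  refine le_of_mul_le_mul_right ?_ (Nat.cast_pos.2 hF)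
  linarith

end Converse

section Privacy

variable {K N F : ℕ} (C : CachingScheme K N F) {p : Fin N → ℝ}

/-- The bijection of the sample space that relabels the server randomness depending on the demands.
It serves to exhibit what a user sees as independent of the demands of the others. -/
def relabel (σ : Demands K N → Equiv.Perm C.Rand) : Equiv.Perm C.Sample where
  toFun ω := (σ ω.2.2 ω.1, ω.2)
  invFun ω := ((σ ω.2.2).symm ω.1, ω.2)
  left_inv ω := by simp
  right_inv ω := by simp

theorem isPrivate_of_relabel (hp : ∑ i, p i = 1) (σ : Demands K N → Equiv.Perm C.Rand)
    (hσ : ∀ d θ, C.randLaw (σ d θ) = C.randLaw θ)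
    (g : Fin K → C.Rand × Files N F × Fin N → C.Cache × C.Msg)
    (hg : ∀ k θ w d, (C.place k θ w, C.deliver θ w d) = g k (σ d θ, w, d k)) :
    C.IsPrivate p := by
  intro k
  have hlaw : ∀ ω, C.law p ω = C.law p (C.relabel σ ω) := fun ω => by
    simp only [law, relabel, Equiv.coe_fn_mk, hσ]
  have hind := (C.isIndep_otherDemands hp k fun t => ((t.2.2, g k t), t.2.1)).comp_equiv
    (C.relabel σ) hlaw
  refine IsIndep.condMutualInfo_eq_zero ?_ (C.isIndep_otherDemands_allFiles hp k) (C.sum_law hp)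
  have hview : (fun ω => ((C.demand k ω, C.cacheContent k ω, C.message ω), C.allFiles ω)) =
      fun ω : C.Sample => ((ω.2.2 k, g k (σ ω.2.2 ω.1, ω.2.1, ω.2.2 k)), ω.2.1) :=
    funext fun ω => congrArg (fun v => ((ω.2.2 k, v), ω.2.1)) (hg k ω.1 ω.2.1 ω.2.2)
  rw [hview]
  exact hind

end Privacy

end CachingScheme

section Subfiles

variable {ι κ A : Type*} [Fintype ι] [AddCommGroup A]

variable (ι A) in
/-- The rows of subfiles with vanishing sum, from which the broadcast arrays are built. -/
def zeroSum : AddSubgroup (ι → A) where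
  carrier := {y | ∑ i, y i = 0}
  zero_mem' := by simp
  add_mem' {y z} hy hz := by simp_all [sum_add_distrib]
  neg_mem' {y} hy := by simp_all

variable (A) in
theorem natCard_zeroSum (n : ℕ) : Nat.card (zeroSum (Fin (n + 1)) A) = Nat.card A ^ n := by
  have e : zeroSum (Fin (n + 1)) A ≃ (Fin n → A) :=
    { toFun y := Fin.tail y.1
      invFun z := ⟨Fin.cons (-∑ i, z i) z, by simp [zeroSum, Fin.sum_univ_succ]⟩
      left_inv y := by
        have h : y.1 0 + ∑ i : Fin n, y.1 i.succ = 0 := (Fin.sum_univ_succ y.1).symm.trans y.2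
        ext i
        cases i using Fin.cases
        · simpa [Fin.tail] using (eq_neg_of_add_eq_zero_left h).symm
        · simp [Fin.tail]
      right_inv z := by simp }
  rw [Nat.card_congr e, Nat.card_fun, Nat.card_fin]

variable [DecidableEq ι]

/-- The row with entry `a` in column `i` and `-a` in column `j`, which moves the sum of a row from
column `j` to column `i`. -/
def transfer (i j : ι) (a : A) : zeroSum ι A :=
  ⟨Pi.single i a - Pi.single j a, by simp [zeroSum, sum_sub_distrib]⟩

/-- A file, cut into an array of subfiles with one row for each user `k : κ` and one column for each
file, all of whose rows have the same sum. The array is encoded by that sum and by the rows that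
remain when the sum is subtracted in column `0`. -/
abbrev Subfiles (κ ι A : Type*) [Fintype ι] [AddCommGroup A] : Type _ := A × (κ → zeroSum ι A)

variable [AddCommGroup ι]

/-- The entry of virtual user `(k, s)` in an array of subfiles. -/
def Subfiles.entry (x : Subfiles κ ι A) (k : κ) (s : ι) : A :=
  (x.2 k : ι → A) s + Pi.single (M := fun _ => A) 0 x.1 s

/-- The array that is broadcast for file `m`: the common row sum is subtracted at every virtual user
that demands `m`, where `(k, s)` demands `s + q k`. -/
def Subfiles.residual (x : Subfiles κ ι A) (q : κ → ι) (m : ι) : κ → zeroSum ι A :=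
  fun k => x.2 k + transfer 0 (m - q k) x.1

theorem Subfiles.entry_eq (x : Subfiles κ ι A) (q : κ → ι) (m : ι) (k : κ) (s : ι) :
    x.entry k s = (x.residual q m k : ι → A) s + if s + q k = m then x.1 else 0 := by
  simp only [entry, residual, transfer, AddSubgroup.coe_add, Pi.add_apply, Pi.sub_apply,
    Pi.single_apply (m - q k), eq_sub_iff_add_eq]
  abel

theorem Subfiles.sum_entry (x : ι → Subfiles κ ι A) (q : κ → ι) (k : κ) (s : ι) :
    ∑ m, (x m).entry k s = ∑ m, ((x m).residual q m k : ι → A) s + (x (s + q k)).1 := by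
  simp only [fun m => (x m).entry_eq q m k s, sum_add_distrib, sum_ite_eq, mem_univ, if_true]

theorem Subfiles.eq_of_residual_eq {x x' : ι → Subfiles κ ι A} {q : κ → ι} {k : κ} {s : ι}
    (hresidual : ∀ m, (x m).residual q m = (x' m).residual q m)
    (hsum : ∑ m, (x m).entry k s = ∑ m, (x' m).entry k s) : x (s + q k) = x' (s + q k) := by
  have hrowSum : (x (s + q k)).1 = (x' (s + q k)).1 := by
    simpa only [sum_entry _ q, hresidual, add_right_inj] using hsum
  refine Prod.ext hrowSum (funext fun j => ?_)
  simpa only [residual, hrowSum, add_left_inj] using congrFun (hresidual (s + q k)) j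

end Subfiles

section VirtualUserScheme

variable {K n F : ℕ} {A B : Type} [AddCommGroup A] [Finite A] [Finite B]
  (e : Fin (2 ^ F) ≃ Subfiles (Fin K) (Fin (n + 1)) A × B)

/-- The scheme in which user `k` plays the role of virtual user `(k, S k)`, with `S k` uniformly
random, and the message depends on the demands only through the shifts `d k - S k`. The component
in `B` of a file is not coded at all but broadcast as it is. -/
noncomputable def virtualUserScheme : CachingScheme K (n + 1) F where
  Rand := Fin K → Fin (n + 1)
  Cache := Fin (n + 1) × A
  Msg := (Fin K → Fin (n + 1)) × (Fin (n + 1) → (Fin K → zeroSum (Fin (n + 1)) A) × B)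
  fintypeCache := Fintype.ofFinite _
  fintypeMsg := Fintype.ofFinite _
  randLaw _ := 1 / (n + 1) ^ K
  randLaw_nonneg _ := by positivity
  randLaw_sum := by
    have : (n : ℝ) + 1 ≠ 0 := by positivity
    simp [this]
  place k S w := (S k, ∑ m, (e (w m)).1.entry k (S k))
  deliver S w d := (d - S, fun m => ((e (w m)).1.residual (d - S) m, (e (w m)).2))

theorem isDecodable_virtualUserScheme (p : Fin (n + 1) → ℝ) :
    (virtualUserScheme e).IsDecodable p := by
  refine fun k => condEntropy_eq_zero_of_determined ?_
  rintro ⟨(S : Fin K → Fin (n + 1)), w, d⟩ ⟨(S' : Fin K → Fin (n + 1)), w', d'⟩ h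
  simp only [CachingScheme.cacheContent, CachingScheme.demand, CachingScheme.message,
    virtualUserScheme, Prod.mk.injEq] at h
  obtain ⟨⟨hS, hcache⟩, hd, hq, hmsg⟩ := h
  rw [← hS] at hcache
  rw [← hq] at hmsg
  have hsubfiles := Subfiles.eq_of_residual_eq (x := fun m => (e (w m)).1)
    (x' := fun m => (e (w' m)).1) (fun m => (Prod.mk.inj (congrFun hmsg m)).1) hcache
  rw [Pi.sub_apply, add_sub_cancel] at hsubfiles
  have hfile : w (d k) = w' (d k) :=
    e.injective (Prod.ext hsubfiles (Prod.mk.inj (congrFun hmsg (d k))).2)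
  exact hfile.trans (congrArg w' hd)

theorem isPrivate_virtualUserScheme {p : Fin (n + 1) → ℝ} (hp : ∑ i, p i = 1) :
    (virtualUserScheme e).IsPrivate p := by
  refine (virtualUserScheme e).isPrivate_of_relabel hp
    (fun d => Equiv.subLeft (G := Fin K → Fin (n + 1)) d) (fun _ _ => rfl)
    (fun k (q, w, m) => ((m - q k, ∑ i, (e (w i)).1.entry k (m - q k)),
      (q, fun i => ((e (w i)).1.residual q i, (e (w i)).2)))) ?_
  intro k (S : Fin K → Fin (n + 1)) w d
  have hrole : d k - (d - S) k = S k := sub_sub_cancel (d k) (S k)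
  exact congrArg
    (fun s => ((s, ∑ i, (e (w i)).1.entry k s), (virtualUserScheme e).deliver S w d)) hrole.symm

theorem card_cache_virtualUserScheme :
    Fintype.card (virtualUserScheme e).Cache = (n + 1) * Nat.card A := by
  rw [← Nat.card_eq_fintype_card]
  exact (Nat.card_prod _ _).trans (by rw [Nat.card_fin])

theorem card_msg_virtualUserScheme :
    Fintype.card (virtualUserScheme e).Msg =
      (n + 1) ^ K * ((Nat.card A ^ n) ^ K * Nat.card B) ^ (n + 1) := by
  rw [← Nat.card_eq_fintype_card]
  exact (Nat.card_prod _ _).trans (by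
    simp only [Nat.card_fun, Nat.card_prod, Nat.card_fin, natCard_zeroSum])

end VirtualUserScheme

section Achievability

theorem exists_private_scheme {K n F t : ℕ} {p : Fin (n + 1) → ℝ} (hp : ∑ i, p i = 1)
    (ht : (K * n + 1) * t ≤ F) :
    ∃ C : CachingScheme K (n + 1) F, C.IsDecodable p ∧ C.IsPrivate p ∧
      Fintype.card C.Cache = (n + 1) * 2 ^ t ∧
      Fintype.card C.Msg = (n + 1) ^ K * 2 ^ ((n + 1) * (F - t)) := by
  obtain ⟨r, rfl⟩ := Nat.exists_eq_add_of_le ht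
  let A := ZMod (2 ^ t)
  have hA : Nat.card A = 2 ^ t := Nat.card_zmod _
  have hcard : Nat.card (Subfiles (Fin K) (Fin (n + 1)) A × Fin (2 ^ r)) =
      2 ^ ((K * n + 1) * t + r) := by
    simp only [Nat.card_prod, Nat.card_fun, Nat.card_fin, natCard_zeroSum, hA]
    ring
  let e := (Finite.equivFinOfCardEq hcard).symm
  refine ⟨virtualUserScheme e, isDecodable_virtualUserScheme e p, isPrivate_virtualUserScheme e hp,
    by rw [card_cache_virtualUserScheme, hA], ?_⟩
  have hsub : (K * n + 1) * t + r - t = K * n * t + r := by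
    rw [add_one_mul, add_right_comm, Nat.add_sub_cancel]
  rw [card_msg_virtualUserScheme, hA, Nat.card_fin, hsub]
  ring

theorem natCast_le_two_rpow {c a : ℕ} {b : ℝ} (hc : c ≤ 2 ^ a) (hab : a ≤ b) :
    (c : ℝ) ≤ 2 ^ b := calc
  (c : ℝ) ≤ 2 ^ (a : ℝ) := by
    rw [rpow_natCast]
    exact_mod_cast hc
  _ ≤ 2 ^ b := rpow_le_rpow_of_exponent_le one_le_two hab

theorem privatelyAchievable_of_mul_le_one {K n : ℕ} {p : Fin (n + 1) → ℝ} (hp : ∑ i, p i = 1)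
    {M : ℝ} (hM₀ : 0 ≤ M) (hM : M * (K * n + 1) ≤ 1) :
    PrivatelyAchievable K (n + 1) p M ((n + 1) * (1 - M)) := by
  intro ε hε
  refine ⟨⌈(n * (K + 1) + 1) / ε⌉₊, fun F hF => ?_⟩
  have hoverhead : (n * (K + 1) + 1 : ℝ) ≤ ε * F := by
    rw [mul_comm ε, ← div_le_iff₀ hε]
    exact Nat.ceil_le.1 hF
  set t := ⌊M * F⌋₊
  have ht_le : (t : ℝ) ≤ M * F := Nat.floor_le (by positivity)
  have ht_gt : M * F < t + 1 := Nat.lt_floor_add_one _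
  have htF : (K * n + 1) * t ≤ F := by
    have : ((K : ℝ) * n + 1) * t ≤ F := calc
      ((K : ℝ) * n + 1) * t ≤ (K * n + 1) * (M * F) := by gcongr
      _ = M * (K * n + 1) * F := by ring
      _ ≤ F := mul_le_of_le_one_left F.cast_nonneg hM
    exact_mod_cast this
  have htF' : t ≤ F := (Nat.le_mul_of_pos_left t (Nat.succ_pos _)).trans htF
  obtain ⟨C, hdec, hpriv, hcache, hmsg⟩ := exists_private_scheme (K := K) hp htF
  have hn : n + 1 ≤ 2 ^ n := Nat.lt_two_pow_self
  have hnK : (0 : ℝ) ≤ n * K := by positivity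
  refine ⟨C, hdec, hpriv, natCast_le_two_rpow (a := n + t) ?_ ?_,
    natCast_le_two_rpow (a := n * K + (n + 1) * (F - t)) ?_ ?_⟩
  · rw [hcache, pow_add]
    gcongr
  · push_cast
    linarith
  · rw [hmsg, pow_add, pow_mul 2 n K]
    exact Nat.mul_le_mul_right _ (Nat.pow_le_pow_left hn K)
  · push_cast [htF']
    nlinarith [n.cast_nonneg (α := ℝ)]

theorem privatelyAchievable_of_mem_Icc {K N : ℕ} {p : Fin N → ℝ} (hp : ∑ i, p i = 1) {M : ℝ}
    (hM : M ∈ Set.Icc (0 : ℝ) (1 / (K * (N - 1) + 1))) :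
    PrivatelyAchievable K N p M (N * (1 - M)) := by
  obtain _ | n := N
  · simp at hp
  obtain ⟨hM₀, hM₁⟩ := hM
  rw [Nat.cast_add_one, add_sub_cancel_right, le_div_iff₀ (by positivity)] at hM₁
  rw [Nat.cast_add_one]
  exact privatelyAchievable_of_mul_le_one hp hM₀ hM₁

end Achievability

theorem PrivatelyAchievable.rate_lower_bound {K N : ℕ} {p : Fin N → ℝ} {M R : ℝ}
    (h : PrivatelyAchievable K N p M R) (hp : ∀ i, 0 < p i) (hp_sum : ∑ i, p i = 1) (hK : 1 ≤ K)
    (hKN : 2 ≤ K ∨ N = 1) : (N : ℝ) * (1 - M) ≤ R := by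
  refine le_of_forall_pos_le_add fun δ hδ => ?_
  obtain ⟨F₀, hF₀⟩ := h (δ / (N + 1)) (by positivity)
  obtain ⟨C, hC⟩ := hF₀ (F₀ + 1) F₀.le_succ
  have hbound := hC.rate_lower_bound hp hp_sum hK hKN F₀.succ_pos
  have hδN : δ / ((N : ℝ) + 1) * (N + 1) = δ := div_mul_cancel₀ δ (by positivity)
  linarith

theorem isOptimalPrivateRate_of_mem_Icc {K N : ℕ} {p : Fin N → ℝ} (hp : ∀ i, 0 < p i)
    (hp_sum : ∑ i, p i = 1) (hK : 1 ≤ K) (hKN : 2 ≤ K ∨ N = 1) {M : ℝ}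
    (hM : M ∈ Set.Icc (0 : ℝ) (1 / (K * (N - 1) + 1))) :
    IsOptimalPrivateRate K N p M (N * (1 - M)) :=
  ⟨privatelyAchievable_of_mem_Icc hp_sum hM, fun _ hR => hR.rate_lower_bound hp hp_sum hK hKN⟩

end CodedCaching

theorem theorem3 (K N : ℕ) (hK : 1 ≤ K) (hN : 1 ≤ N)
    (p : Fin N → ℝ) (hp_pos : ∀ i, 0 < p i) (hp_sum : ∑ i, p i = 1) :
    CodedCaching.PrivatelyAchievable K N p
      (1 / ((K : ℝ) * ((N : ℝ) - 1) + 1))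
      ((N : ℝ) * (1 - 1 / ((K : ℝ) * ((N : ℝ) - 1) + 1))) ∧
    ((2 ≤ K ∨ N = 1) →
      ∀ M ∈ Set.Icc (0 : ℝ) (1 / ((K : ℝ) * ((N : ℝ) - 1) + 1)),
        CodedCaching.IsOptimalPrivateRate K N p M ((N : ℝ) * (1 - M)) ∧
        ∀ (F : ℕ) (R : ℝ), 1 ≤ F →
          (∃ C : CodedCaching.CachingScheme K N F, C.IsDemandPrivateScheme p M R) →
          (N : ℝ) * (1 - M) ≤ R) := by
  have hL : (0 : ℝ) ≤ 1 / ((K : ℝ) * ((N : ℝ) - 1) + 1) := by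
    have : (0 : ℝ) ≤ (N : ℝ) - 1 := sub_nonneg.2 (Nat.one_le_cast.2 hN)
    positivity
  refine ⟨CodedCaching.privatelyAchievable_of_mem_Icc hp_sum (Set.right_mem_Icc.2 hL),
    fun hKN M hM =>
      ⟨CodedCaching.isOptimalPrivateRate_of_mem_Icc hp_pos hp_sum hK hKN hM, ?_⟩⟩
  rintro F R hF ⟨C, hC⟩
  exact hC.rate_lower_bound hp_pos hp_sum hK hKN hF
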